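/- Let $\mathcal H$ be a separable complex Hilbert space and let $q$ be a positive semi-definite sesquilinear form with dense form domain $\mathrm{Dom}\,q\subseteq\mathcal H$. Conventions. Inner products and forms are conjugate-linear in the first variable. For densely defined positive semi-definite forms, $p\le q$ means that $\mathrm{Dom}\,q\subseteq\mathrm{Dom}\,p$ and $p(x,x)\le q(x,x)$ for all $x\in\mathrm{Dom}\,q$. A form $q$ is closed if $\mathrm{Dom}\,q$ is complete for the inner product $\langle x,y\rangle_{\mathcal H}+q(x,y)$, and closeable if it has a closed extension; the closure of a closeable form is its smallest closed extension. The absolutely continuous part $q_{ac}$ of $q$ is the largest closeable form $\le q$. The form of a (densely defined, possibly unbounded) positive semi-definite self-adjoint operator $T$ is $q_T(x,y)=\langle\sqrt T x,\sqrt T y\rangle_{\mathcal H}$ with $\mathrm{Dom}\,q_T=\mathrm{Dom}\,\sqrt T$, where $\sqrt T$ is the positive semi-definite self-adjoint square root of $T$. Finally, $\hat{\mathcal H}(q)$ is the Hilbert space completion of $\mathrm{Dom}\,q$ with respect to the inner product $\langle x,y\rangle_{\mathcal H}+q(x,y)$, $\mathrm j_q:\mathrm{Dom}\,q\to\hat{\mathcal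 H}(q)$ is the canonical embedding, and the co-embedding $E_q:\hat{\mathcal H}(q)\to\mathcal H$ is the continuous extension of the map $\mathrm j_q(x)\mapsto x$. Theorem. There is exactly one positive semi-definite self-adjoint operator $T$ in $\mathcal H$ whose form $q_T$ is the closure $\overline{q_{ac}}$ of the absolutely continuous part of $q$. The co-embedding $E_q$ is a contraction, $\|E_q\|\le 1$. Moreover, for this $T$, $$(I+T)^{-1}=E_qE_q^*,$$ that is, $I+T:\mathrm{Dom}\,T\to\mathcal H$ is a bijection whose inverse is the everywhere defined bounded operator $E_qE_q^*$. -/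

import Mathlib

/-- A densely defined, positive semi-definite sesquilinear form in `H`, with form domain `domain`
(conjugate-linear in the first variable, linear in the second). -/
structure PosForm (H : Type*) [NormedAddCommGroup H] [InnerProductSpace ℂ H] where
  /-- the form domain -/
  domain : Submodule ℂ H
  /-- the form domain is dense -/
  dense : Dense (domain : Set H)
  /-- the sesquilinear form -/
  form : domain →ₗ⋆[ℂ] domain →ₗ[ℂ] ℂ
  /-- `form x x` is real -/
  im_self : ∀ x, (form x x).im = 0
  /-- `form x x` is nonnegative -/
  re_self_nonneg : ∀ x, 0 ≤ (form x x).re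

namespace PosForm

variable {H : Type*} [NormedAddCommGroup H] [InnerProductSpace ℂ H]

/-- Positive semi-definite complex sesquilinear forms are Hermitian (polarization). -/
theorem conj_form (q : PosForm H) (x y : q.domain) :
    (starRingEnd ℂ) (q.form y x) = q.form x y := by
  have h1 := q.im_self (x + y)
  have h2 := q.im_self (x + Complex.I • y)
  have hx := q.im_self x
  have hy := q.im_self y
  simp only [map_add, LinearMap.add_apply, LinearMap.map_smulₛₗ, LinearMap.smul_apply,
    smul_eq_mul, Complex.conj_I, Complex.add_im, Complex.add_re, Complex.mul_im, Complex.mul_re,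
    Complex.I_re, Complex.I_im, Complex.neg_re, Complex.neg_im, RingHom.id_apply] at h1 h2
  apply Complex.ext
  · simp only [Complex.conj_re]
    linarith
  · simp only [Complex.conj_im]
    linarith

/-- The form domain of `q`, regarded as an inner product space with the inner product
`⟪x, y⟫_H + q (x, y)`. -/
def FormSpace (q : PosForm H) : Type _ := q.domain

instance (q : PosForm H) : AddCommGroup q.FormSpace := inferInstanceAs (AddCommGroup q.domain)

instance (q : PosForm H) : Module ℂ q.FormSpace := inferInstanceAs (Module ℂ q.domain)

/-- The inner product `⟪x, y⟫_H + q (x, y)` on the form domain. -/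
@[reducible] noncomputable def core (q : PosForm H) : InnerProductSpace.Core ℂ q.FormSpace where
  inner := fun (x y : q.domain) => inner ℂ (x : H) (y : H) + q.form x y
  conj_inner_symm := fun (x y : q.domain) => by
    change (starRingEnd ℂ) (inner ℂ (y : H) (x : H) + q.form y x) = _
    rw [map_add, inner_conj_symm, q.conj_form]
  re_inner_nonneg := fun (x : q.domain) => by
    change 0 ≤ (inner ℂ (x : H) (x : H) + q.form x x).re
    rw [Complex.add_re]
    exact add_nonneg (inner_self_nonneg (𝕜 := ℂ) (x := (x : H))) (q.re_self_nonneg x)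
  add_left := fun (x y z : q.domain) => by
    change inner ℂ ((x : H) + (y : H)) (z : H) + q.form (x + y) z =
      (inner ℂ (x : H) (z : H) + q.form x z) + (inner ℂ (y : H) (z : H) + q.form y z)
    rw [inner_add_left, map_add, LinearMap.add_apply]
    ring
  smul_left := fun (x y : q.domain) r => by
    change inner ℂ (r • (x : H)) (y : H) + q.form (r • x) y =
      (starRingEnd ℂ) r * (inner ℂ (x : H) (y : H) + q.form x y)
    rw [inner_smul_left, LinearMap.map_smulₛₗ, LinearMap.smul_apply, smul_eq_mul]
    ring
  definite := fun (x : q.domain) h => by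
    change inner ℂ (x : H) (x : H) + q.form x x = 0 at h
    have h1 := congrArg Complex.re h
    rw [Complex.add_re, Complex.zero_re] at h1
    have h2 : 0 ≤ (inner ℂ (x : H) (x : H)).re := inner_self_nonneg (𝕜 := ℂ) (x := (x : H))
    have h3 : (inner ℂ (x : H) (x : H)).re = 0 := by linarith [q.re_self_nonneg x]
    have h4 : (x : H) = 0 := by
      rw [← norm_eq_zero, ← sq_eq_zero_iff, ← inner_self_eq_norm_sq (𝕜 := ℂ)]
      exact h3
    exact Subtype.ext h4

noncomputable instance (q : PosForm H) : NormedAddCommGroup q.FormSpace :=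
  q.core.toNormedAddCommGroup

noncomputable instance (q : PosForm H) : InnerProductSpace ℂ q.FormSpace :=
  InnerProductSpace.ofCore q.core.toCore

/-- The inner product of `q.FormSpace` is `⟪x, y⟫_H + q (x, y)`. -/
theorem formSpace_inner (q : PosForm H) (x y : q.domain) :
    inner ℂ (show q.FormSpace from x) (show q.FormSpace from y) =
      inner ℂ (x : H) (y : H) + q.form x y := rfl

/-- `Ĥ(q)`: the Hilbert space completion of the form domain with respect to
`⟪x, y⟫_H + q (x, y)`. -/
abbrev FormCompletion (q : PosForm H) : Type _ := UniformSpace.Completion q.FormSpace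

/-- The formal embedding `j_q` of the form domain into `Ĥ(q)`. -/
noncomputable def embed (q : PosForm H) (x : q.domain) : q.FormCompletion :=
  ((show q.FormSpace from x : q.FormSpace) : UniformSpace.Completion q.FormSpace)

/-- The inclusion of the form domain in `H`, as a linear map on `q.FormSpace`. -/
def inclusionₗ (q : PosForm H) : q.FormSpace →ₗ[ℂ] H := q.domain.subtype

/-- The inclusion of the form domain in `H` is contractive for the form norm. -/
theorem norm_inclusionₗ_le (q : PosForm H) (x : q.FormSpace) :
    ‖q.inclusionₗ x‖ ≤ 1 * ‖x‖ := by
  rw [one_mul]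
  refine le_of_sq_le_sq ?_ (norm_nonneg _)
  have h1 : ‖x‖ ^ 2 = RCLike.re (inner ℂ x x) := (inner_self_eq_norm_sq (𝕜 := ℂ) x).symm
  have h2 : ‖q.inclusionₗ x‖ ^ 2 = RCLike.re (inner ℂ (q.inclusionₗ x) (q.inclusionₗ x)) :=
    (inner_self_eq_norm_sq (𝕜 := ℂ) _).symm
  rw [h1, h2]
  exact le_add_of_nonneg_right (q.re_self_nonneg x)

/-- The inclusion of the form domain (with the form norm) in `H`, a contraction. -/
noncomputable def inclusion (q : PosForm H) : q.FormSpace →L[ℂ] H :=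
  q.inclusionₗ.mkContinuous 1 q.norm_inclusionₗ_le

/-- The co-embedding `E_q : Ĥ(q) → H`: the continuous extension of `j_q x ↦ x`. -/
noncomputable def coEmbedding [CompleteSpace H] (q : PosForm H) : q.FormCompletion →L[ℂ] H :=
  q.inclusion.extend (UniformSpace.Completion.toComplL (𝕜 := ℂ) (E := q.FormSpace))

/-- The defining property `E_q (j_q x) = x`. -/
theorem coEmbedding_embed [CompleteSpace H] (q : PosForm H) (x : q.domain) :
    q.coEmbedding (q.embed x) = x :=
  ContinuousLinearMap.extend_eq q.inclusion
    (UniformSpace.Completion.denseRange_coe (α := q.FormSpace))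
    (UniformSpace.Completion.isUniformInducing_coe q.FormSpace) x

/-- The (Kato, Simon) order on forms: `p ≤ q` if `Dom q ⊆ Dom p` and `p (x, x) ≤ q (x, x)` for all
`x ∈ Dom q`. -/
instance : LE (PosForm H) where
  le p q := ∃ h : q.domain ≤ p.domain, ∀ x : q.domain,
    (p.form ⟨x, h x.2⟩ ⟨x, h x.2⟩).re ≤ (q.form x x).re

/-- `p` is an extension of `q`. -/
def IsExtension (p q : PosForm H) : Prop :=
  ∃ h : q.domain ≤ p.domain, ∀ x y : q.domain,
    p.form ⟨x, h x.2⟩ ⟨y, h y.2⟩ = q.form x y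

/-- A form is closed if its domain is complete for the inner product `⟪x, y⟫_H + q (x, y)`. -/
def IsClosed (q : PosForm H) : Prop := CompleteSpace q.FormSpace

/-- A form is closeable (absolutely continuous) if it has a closed extension. -/
def IsCloseable (q : PosForm H) : Prop := ∃ p : PosForm H, p.IsClosed ∧ p.IsExtension q

/-- `p` is the closure of `q`: the smallest closed extension of `q`. -/
def IsClosureOf (p q : PosForm H) : Prop :=
  p.IsClosed ∧ p.IsExtension q ∧ ∀ r : PosForm H, r.IsClosed → r.IsExtension q → r.IsExtension p

/-- `p` is the absolutely continuous part of `q`: the largest closeable form below `q`. -/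
def IsACPartOf (p q : PosForm H) : Prop := IsGreatest {r : PosForm H | r.IsCloseable ∧ r ≤ q} p

end PosForm

namespace LinearPMap

variable {H : Type*} [NormedAddCommGroup H] [InnerProductSpace ℂ H]

/-- `T` is a (densely defined, possibly unbounded) positive semi-definite self-adjoint operator. -/
def IsPosSelfAdjoint [CompleteSpace H] (T : H →ₗ.[ℂ] H) : Prop :=
  IsSelfAdjoint T ∧ ∀ x : T.domain, 0 ≤ (inner ℂ (x : H) (T x)).re

/-- `S` is the positive square root of `T`: `S` is positive self-adjoint and `T = S ∘ S`, where
`Dom (S ∘ S) = {x ∈ Dom S | S x ∈ Dom S}`. -/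
def IsPosSqrtOf [CompleteSpace H] (S T : H →ₗ.[ℂ] H) : Prop :=
  S.IsPosSelfAdjoint ∧
    ∀ x y : H, (x, y) ∈ T.graph ↔ ∃ z : H, (x, z) ∈ S.graph ∧ (z, y) ∈ S.graph

/-- `A : Dom A → H` is bijective, with everywhere defined bounded inverse `A⁻¹ = B`. -/
def HasBoundedInverse (A : H →ₗ.[ℂ] H) (B : H →L[ℂ] H) : Prop :=
  (∀ x : A.domain, B (A x) = x) ∧ ∀ y : H, ∃ h : B y ∈ A.domain, A ⟨B y, h⟩ = y

end LinearPMap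

/-- `q = q_T` is the form of the positive self-adjoint operator `T`: `Dom q = Dom √T` and
`q (x, y) = ⟪√T x, √T y⟫`. -/
def PosForm.IsFormOf {H : Type*} [NormedAddCommGroup H] [InnerProductSpace ℂ H] [CompleteSpace H]
    (q : PosForm H) (T : H →ₗ.[ℂ] H) : Prop :=
  T.IsPosSelfAdjoint ∧ ∃ S : H →ₗ.[ℂ] H, S.IsPosSqrtOf T ∧
    ∃ h : q.domain = S.domain, ∀ x y : q.domain,
      q.form x y = inner ℂ (S ⟨x, h.le x.2⟩) (S ⟨y, h.le y.2⟩)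

/-! Write `E` for the co-embedding of `q`. Its kernel is what keeps `q` from being closeable. Give
`range E` the quotient norm of `Ĥ(q)`, that is, the norm of the unique preimage in `(ker E)ᗮ`, and
subtract the inner product of `H`: this is the closed form `rangeForm`, and its restriction to `Dom
q` is `acPart`. Both extremal properties rest on `exists_factor_coEmbedding`: for a closed form `r ≤
q`, `E` factors as a contraction `W` into the form space of `r` followed by the injective inclusion.
So `W` kills `ker E`, and the form norm of `r` is at most the quotient norm.

For the operator, put `B = E E†`, so that `0 ≤ B ≤ 1` and `B` is injective because `E` has dense
range. Then `T = B⁻¹ - 1` has graph `{(B z, (1 - B) z)}`. With `C = √B` and `D = √(1 - B)`, its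
square root has graph `{(C z, D z)}`. The polar decomposition `E† = U C` gives `range C = range E`
and shows that the lift of `C z` is `U z`, so `rangeForm` at `(C z, C w)` equals `⟪z, w⟫ - ⟪C z, C
w⟫ = ⟪D z, D w⟫`. Uniqueness of `T` holds because a form determines the graph of its operator
(`IsFormOf.mem_graph_iff`). -/

open scoped InnerProductSpace

/-! ### Unbounded operators as quotients of commuting bounded ones -/

namespace ContinuousLinearMap

variable {H : Type*} [NormedAddCommGroup H] [InnerProductSpace ℂ H]

/-- The partially defined operator `C z ↦ D z` (meaningful for injective `C`). -/
noncomputable def rangePMap (C D : H →L[ℂ] H) : H →ₗ.[ℂ] H :=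
  (LinearMap.range (C.prod D : H →ₗ[ℂ] H × H)).toLinearPMap

theorem mem_graph_rangePMap {C D : H →L[ℂ] H} (hC : Function.Injective C) {x y : H} :
    (x, y) ∈ (rangePMap C D).graph ↔ ∃ z, C z = x ∧ D z = y := by
  rw [rangePMap, Submodule.toLinearPMap_graph_eq]
  · simp
  · rintro _ ⟨z, rfl⟩ hz
    have : z = 0 := hC (by simpa using hz)
    simp [this]

theorem mem_domain_rangePMap {C D : H →L[ℂ] H} (hC : Function.Injective C) {x : H} :
    x ∈ (rangePMap C D).domain ↔ ∃ z, C z = x := by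
  simp [LinearPMap.mem_domain_iff, mem_graph_rangePMap hC]

theorem rangePMap_apply {C D : H →L[ℂ] H} (hC : Function.Injective C)
    (x : (rangePMap C D).domain) {z : H} (hz : C z = x) : rangePMap C D x = D z := by
  obtain ⟨w, hw, hw'⟩ := (mem_graph_rangePMap hC).1 ((rangePMap C D).mem_graph x)
  rw [← hw', hC (hw.trans hz.symm)]

theorem hasBoundedInverse_id_vadd_rangePMap {B : H →L[ℂ] H} (hB : Function.Injective B) :
    ((LinearMap.id : H →ₗ[ℂ] H) +ᵥ rangePMap B (1 - B)).HasBoundedInverse B := by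
  have key (x : (rangePMap B (1 - B)).domain) (z : H) (hz : B z = x) :
      (x : H) + rangePMap B (1 - B) x = z := by
    rw [rangePMap_apply hB x hz, ← hz]
    simp
  refine ⟨fun x => ?_, fun y =>
    ⟨(mem_domain_rangePMap hB).2 ⟨y, rfl⟩, key ⟨B y, (mem_domain_rangePMap hB).2 ⟨y, rfl⟩⟩ y rfl⟩⟩
  obtain ⟨z, hz⟩ := (mem_domain_rangePMap hB).1 x.2
  exact (congrArg B (key x z hz)).trans hz

variable [CompleteSpace H]

theorem _root_.IsSelfAdjoint.denseRange_of_injective {C : H →L[ℂ] H} (hs : IsSelfAdjoint C)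
    (hC : Function.Injective C) : DenseRange C := by
  have h : (LinearMap.range (C : H →ₗ[ℂ] H)).topologicalClosure = ⊤ := by
    rw [Submodule.topologicalClosure_eq_top_iff, ContinuousLinearMap.orthogonal_range,
      hs.adjoint_eq]
    exact LinearMap.ker_eq_bot.2 hC
  exact Submodule.dense_iff_topologicalClosure_eq_top.2 h

/-- A pair `(a, b)` lies in the adjoint graph iff `D a = C b`. The Bézout identity `U C + V D = 1`
then yields the parameter `z = U a + V b` with `C z = a` and `D z = b`. It is applied with `U = V =
1` to `B, 1 - B`, and with `U = C`, `V = D` to the square roots. -/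
theorem isPosSelfAdjoint_rangePMap {C D U V : H →L[ℂ] H} (hC : Function.Injective C)
    (hCs : IsSelfAdjoint C) (hDs : IsSelfAdjoint D) (hCD : Commute C D) (hUC : Commute U C)
    (hUD : Commute U D) (hVC : Commute V C) (hVD : Commute V D) (hUV : U * C + V * D = 1)
    (hpos : 0 ≤ C * D) : (rangePMap C D).IsPosSelfAdjoint := by
  have sC (x y : H) : ⟪C x, y⟫_ℂ = ⟪x, C y⟫_ℂ := by
    conv_lhs => rw [← hCs.adjoint_eq]
    exact adjoint_inner_left C y x
  have sD (x y : H) : ⟪D x, y⟫_ℂ = ⟪x, D y⟫_ℂ := by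
    conv_lhs => rw [← hDs.adjoint_eq]
    exact adjoint_inner_left D y x
  have cm {A A' : H →L[ℂ] H} (h : Commute A A') (x : H) : A (A' x) = A' (A x) :=
    congrArg (fun F : H →L[ℂ] H => F x) h.eq
  have one (x : H) : U (C x) + V (D x) = x := congrArg (fun F : H →L[ℂ] H => F x) hUV
  have hdense : Dense ((rangePMap C D).domain : Set H) := by
    have : ((rangePMap C D).domain : Set H) = Set.range C := by
      ext x
      exact mem_domain_rangePMap hC
    rw [this]
    exact hCs.denseRange_of_injective hC
  refine ⟨?_, fun x => ?_⟩
  · rw [LinearPMap.isSelfAdjoint_def]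
    apply LinearPMap.eq_of_eq_graph
    rw [LinearPMap.adjoint_graph_eq_graph_adjoint hdense]
    ext ⟨a, b⟩
    rw [Submodule.mem_adjoint_iff, mem_graph_rangePMap hC]
    constructor
    · intro h
      have key : D a = C b := by
        refine ext_inner_left ℂ fun z => ?_
        have := h (C z) (D z) ((mem_graph_rangePMap hC).2 ⟨z, rfl, rfl⟩)
        rw [sub_eq_zero, sD, sC] at this
        exact this
      refine ⟨U a + V b, ?_, ?_⟩
      · rw [map_add, cm hUC.symm, cm hVC.symm, ← key, one]
      · rw [map_add, cm hUD.symm, cm hVD.symm, key, one]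
    · rintro ⟨z, rfl, rfl⟩ _ _ hab
      obtain ⟨w, rfl, rfl⟩ := (mem_graph_rangePMap hC).1 hab
      rw [sub_eq_zero, sD, sC, cm hCD]
  · obtain ⟨z, hz⟩ := (mem_domain_rangePMap hC).1 x.2
    rw [rangePMap_apply hC x hz, ← hz, sC]
    exact ((nonneg_iff_isPositive _).1 hpos).re_inner_nonneg_right z

theorem isPosSelfAdjoint_rangePMap_one_sub {B : H →L[ℂ] H} (hB : Function.Injective B)
    (h0 : 0 ≤ B) (h1 : B ≤ 1) : (rangePMap B (1 - B)).IsPosSelfAdjoint := by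
  have hs := IsSelfAdjoint.of_nonneg h0
  have hc : Commute B (1 - B) := (Commute.one_right B).sub_right (Commute.refl B)
  exact isPosSelfAdjoint_rangePMap hB hs ((IsSelfAdjoint.one _).sub hs) hc (Commute.one_left _)
    (Commute.one_left _) (Commute.one_left _) (Commute.one_left _) (by simp)
    (hc.mul_nonneg h0 (sub_nonneg.2 h1))

/-- The square root of `B⁻¹ - 1` is `√(1 - B) √B⁻¹`. -/
theorem isPosSqrtOf_rangePMap {B C D : H →L[ℂ] H} (hC : Function.Injective C) (hC0 : 0 ≤ C)
    (hD0 : 0 ≤ D) (hCC : C * C = B) (hDD : D * D = 1 - B) (hCD : Commute C D) :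
    (rangePMap C D).IsPosSqrtOf (rangePMap B (1 - B)) := by
  have hB : Function.Injective B := by
    rw [← hCC]
    exact hC.comp hC
  have hsum : C * C + D * D = 1 := by rw [hCC, hDD]; abel
  refine ⟨isPosSelfAdjoint_rangePMap hC (IsSelfAdjoint.of_nonneg hC0) (IsSelfAdjoint.of_nonneg hD0)
    hCD (Commute.refl C) hCD hCD.symm (Commute.refl D) hsum (hCD.mul_nonneg hC0 hD0), ?_⟩
  have cm (x : H) : C (D x) = D (C x) := congrArg (fun F : H →L[ℂ] H => F x) hCD.eq
  have eB (x : H) : B x = C (C x) := congrArg (fun F : H →L[ℂ] H => F x) hCC.symm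
  have eD (x : H) : (1 - B) x = D (D x) := congrArg (fun F : H →L[ℂ] H => F x) hDD.symm
  have one (x : H) : C (C x) + D (D x) = x := congrArg (fun F : H →L[ℂ] H => F x) hsum
  intro x y
  simp only [mem_graph_rangePMap hC, mem_graph_rangePMap hB]
  constructor
  · rintro ⟨z, rfl, rfl⟩
    exact ⟨D (C z), ⟨C z, (eB z).symm, rfl⟩, D z, cm z, (eD z).symm⟩
  · rintro ⟨w, ⟨z, rfl, rfl⟩, v, hv, rfl⟩
    -- Here `C v = D z`, so `C (C z + D v) = C² z + D² z = z`; the witness is the Bézout combination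
    -- again.
    have h : B (C z + D v) = C z := by
      rw [eB, map_add, cm v, hv, one z]
    refine ⟨C z + D v, h, ?_⟩
    rw [sub_apply, h]
    simp

end ContinuousLinearMap

/-! ### Lifting along an operator to the complement of its kernel -/

namespace ContinuousLinearMap

variable {G H : Type*} [NormedAddCommGroup G] [InnerProductSpace ℂ G]
  [NormedAddCommGroup H] [InnerProductSpace ℂ H]

theorem eq_of_mem_ker_orthogonal (E : G →L[ℂ] H) {u v : G}
    (hu : u ∈ (LinearMap.ker (E : G →ₗ[ℂ] H))ᗮ) (hv : v ∈ (LinearMap.ker (E : G →ₗ[ℂ] H))ᗮ)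
    (h : E u = E v) : u = v := by
  rw [← sub_eq_zero, ← inner_self_eq_zero (𝕜 := ℂ)]
  refine (Submodule.mem_orthogonal _ _).1 (Submodule.sub_mem _ hu hv) (u - v) ?_
  simp [h]

variable [CompleteSpace G]

/-- The linear section of `E : G → range E` with values in the orthogonal complement of `ker E`. -/
noncomputable def orthogonalLift (E : G →L[ℂ] H) : LinearMap.range (E : G →ₗ[ℂ] H) →ₗ[ℂ] G :=
  ((LinearMap.ker (E : G →ₗ[ℂ] H))ᗮ.starProjection : G →ₗ[ℂ] G) ∘ₗ
    ((E : G →ₗ[ℂ] H).rangeRestrict.exists_rightInverse_of_surjective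
      (LinearMap.range_rangeRestrict _)).choose

theorem orthogonalLift_mem (E : G →L[ℂ] H) (x : LinearMap.range (E : G →ₗ[ℂ] H)) :
    E.orthogonalLift x ∈ (LinearMap.ker (E : G →ₗ[ℂ] H))ᗮ :=
  Submodule.starProjection_apply_mem _ _

theorem apply_starProjection_ker_orthogonal (E : G →L[ℂ] H) (u : G) :
    E ((LinearMap.ker (E : G →ₗ[ℂ] H))ᗮ.starProjection u) = E u := by
  have : CompleteSpace (LinearMap.ker (E : G →ₗ[ℂ] H)) := E.isClosed_ker.completeSpace_coe
  have h := (LinearMap.ker (E : G →ₗ[ℂ] H))ᗮ.sub_starProjection_mem_orthogonal u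
  rw [Submodule.orthogonal_orthogonal] at h
  have h' : E (u - (LinearMap.ker (E : G →ₗ[ℂ] H))ᗮ.starProjection u) = 0 := h
  rw [map_sub, sub_eq_zero] at h'
  exact h'.symm

theorem apply_orthogonalLift (E : G →L[ℂ] H) (x : LinearMap.range (E : G →ₗ[ℂ] H)) :
    E (E.orthogonalLift x) = x := by
  have h := ((E : G →ₗ[ℂ] H).rangeRestrict.exists_rightInverse_of_surjective
      (LinearMap.range_rangeRestrict _)).choose_spec
  refine (E.apply_starProjection_ker_orthogonal _).trans ?_
  exact congrArg Subtype.val (LinearMap.congr_fun h x)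

theorem orthogonalLift_eq (E : G →L[ℂ] H) {u : G} (hu : u ∈ (LinearMap.ker (E : G →ₗ[ℂ] H))ᗮ)
    (x : LinearMap.range (E : G →ₗ[ℂ] H)) (hx : E u = x) : E.orthogonalLift x = u :=
  E.eq_of_mem_ker_orthogonal (E.orthogonalLift_mem x) hu ((E.apply_orthogonalLift x).trans hx.symm)

/-- Since every preimage projects to the lift, the lift has least norm among them: its norm is the
quotient norm. -/
theorem orthogonalLift_eq_starProjection (E : G →L[ℂ] H) (u : G)
    (x : LinearMap.range (E : G →ₗ[ℂ] H)) (hx : E u = x) :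
    E.orthogonalLift x = (LinearMap.ker (E : G →ₗ[ℂ] H))ᗮ.starProjection u :=
  E.orthogonalLift_eq (Submodule.starProjection_apply_mem _ _) x
    ((E.apply_starProjection_ker_orthogonal u).trans hx)

end ContinuousLinearMap

/-! ### Order and extension of forms; forms built from a lift -/

namespace PosForm

variable {H : Type*} [NormedAddCommGroup H] [InnerProductSpace ℂ H]

theorem ext_form {p r : PosForm H} (h : p.domain = r.domain)
    (hf : ∀ x y : p.domain, p.form x y = r.form ⟨x, h.le x.2⟩ ⟨y, h.le y.2⟩) : p = r := by
  obtain ⟨D, hD, f, h1, h2⟩ := p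
  obtain ⟨D', hD', f', h1', h2'⟩ := r
  obtain rfl : D = D' := h
  obtain rfl : f = f' := LinearMap.ext fun x => LinearMap.ext fun y => hf x y
  rfl

theorem IsExtension.antisymm {p r : PosForm H} (h : p.IsExtension r) (h' : r.IsExtension p) :
    p = r :=
  ext_form (le_antisymm h'.1 h.1) fun x y => (h'.2 x y).symm

theorem IsClosureOf.unique {p r q : PosForm H} (hp : p.IsClosureOf q) (hr : r.IsClosureOf q) :
    p = r :=
  (hr.2.2 p hp.1 hp.2.1).antisymm (hp.2.2 r hr.1 hr.2.1)

theorem IsExtension.le {p r : PosForm H} (h : p.IsExtension r) : p ≤ r :=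
  ⟨h.1, fun x => (congrArg Complex.re (h.2 x x)).le⟩

theorem le_trans' {p r s : PosForm H} (h : p ≤ r) (h' : r ≤ s) : p ≤ s :=
  ⟨h'.1.trans h.1, fun x => (h.2 ⟨x, h'.1 x.2⟩).trans (h'.2 x)⟩

theorem le_antisymm' {p r : PosForm H} (h : p ≤ r) (h' : r ≤ p) : p = r := by
  have hd : p.domain = r.domain := le_antisymm h'.1 h.1
  obtain ⟨D, hD, f, h1, h2⟩ := p
  obtain ⟨D', hD', f', h1', h2'⟩ := r
  obtain rfl : D = D' := hd
  refine ext_form rfl fun x y => ?_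
  have hdiag (z : D) : f z z - f' z z = 0 :=
    sub_eq_zero.2 (Complex.ext (le_antisymm (h.2 z) (h'.2 z)) ((h1 z).trans (h1' z).symm))
  have e1 := hdiag (x + y)
  have e2 := hdiag (x + Complex.I • y)
  have ex := hdiag x
  have ey := hdiag y
  simp only [map_add, LinearMap.add_apply, LinearMap.map_smulₛₗ, LinearMap.smul_apply,
    smul_eq_mul, Complex.conj_I, RingHom.id_apply] at e1 e2
  change f x y = f' x y
  have hI := Complex.I_mul_I
  -- Polarization: the values of `f - f'` at `x + y` and `x + I • y`, corrected by those at `x` and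
  -- `y`, recover `f x y - f' x y`.
  linear_combination (1 / 2) * e1 - (Complex.I / 2) * e2 - ((1 - Complex.I) / 2) * ex
    - (1 / 2 - Complex.I / 2 * (-Complex.I * Complex.I)) * ey
    + ((f x y - f' x y) - (f y x - f' y x)) / 2 * hI

theorem IsACPartOf.unique {p r q : PosForm H} (hp : p.IsACPartOf q) (hr : r.IsACPartOf q) :
    p = r :=
  le_antisymm' (hr.2 hp.1) (hp.2 hr.1)

theorem norm_sq_formSpace (r : PosForm H) (u : r.FormSpace) :
    ‖u‖ ^ 2 = ‖r.inclusion u‖ ^ 2 + (r.form u u).re := by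
  rw [← inner_self_eq_norm_sq (𝕜 := ℂ), ← inner_self_eq_norm_sq (𝕜 := ℂ)]
  rfl

theorem inclusion_injective (r : PosForm H) : Function.Injective r.inclusion :=
  Subtype.val_injective

theorem norm_embed (q : PosForm H) (x : q.domain) :
    ‖q.embed x‖ = ‖(show q.FormSpace from x)‖ :=
  UniformSpace.Completion.norm_coe _

section ofLift

variable {G : Type*} [NormedAddCommGroup G] [InnerProductSpace ℂ G]

/-- The form `⟪L x, L y⟫ - ⟪x, y⟫` of an expanding linear map `L`. -/
noncomputable def ofLift (D : Submodule ℂ H) (hD : Dense (D : Set H)) (L : D →ₗ[ℂ] G)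
    (hL : ∀ x : D, ‖(x : H)‖ ≤ ‖L x‖) : PosForm H where
  domain := D
  dense := hD
  form := LinearMap.mk₂'ₛₗ (starRingEnd ℂ) (RingHom.id ℂ)
    (fun x y => ⟪L x, L y⟫_ℂ - ⟪(x : H), (y : H)⟫_ℂ)
    (fun x y z => by simp only [map_add, Submodule.coe_add, inner_add_left]; ring)
    (fun c x y => by simp only [map_smul, Submodule.coe_smul, inner_smul_left, smul_eq_mul]; ring)
    (fun x y z => by simp only [map_add, Submodule.coe_add, inner_add_right]; ring)
    (fun c x y => by
      simp only [map_smul, Submodule.coe_smul, inner_smul_right, smul_eq_mul, RingHom.id_apply]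
      ring)
  im_self x := by
    change (⟪L x, L x⟫_ℂ - ⟪(x : H), (x : H)⟫_ℂ).im = 0
    rw [inner_self_eq_norm_sq_to_K, inner_self_eq_norm_sq_to_K]
    norm_cast
  re_self_nonneg x := by
    change 0 ≤ (⟪L x, L x⟫_ℂ - ⟪(x : H), (x : H)⟫_ℂ).re
    rw [inner_self_eq_norm_sq_to_K, inner_self_eq_norm_sq_to_K]
    have := pow_le_pow_left₀ (norm_nonneg _) (hL x) 2
    have := sub_nonneg.2 this
    norm_cast

variable {D : Submodule ℂ H} {hD : Dense (D : Set H)} {L : D →ₗ[ℂ] G}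
  {hL : ∀ x : D, ‖(x : H)‖ ≤ ‖L x‖}

theorem ofLift_form (x y : D) :
    (ofLift D hD L hL).form x y = ⟪L x, L y⟫_ℂ - ⟪(x : H), (y : H)⟫_ℂ := rfl

theorem ofLift_form_self_re (x : D) :
    ((ofLift D hD L hL).form x x).re = ‖L x‖ ^ 2 - ‖(x : H)‖ ^ 2 := by
  rw [ofLift_form, inner_self_eq_norm_sq_to_K, inner_self_eq_norm_sq_to_K]
  norm_cast

/-- The form norm of `x` is exactly `‖L x‖`, so `L` is an isometry of the form space onto the
complete space `K`. -/
theorem ofLift_isClosed [CompleteSpace G] (K : Submodule ℂ G) (hK : _root_.IsClosed (K : Set G))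
    (hrange : LinearMap.range L = K) : (ofLift D hD L hL).IsClosed := by
  let i : (ofLift D hD L hL).FormSpace →ₗᵢ[ℂ] G :=
    { toLinearMap := L
      norm_map' := fun x => by
        refine (pow_left_inj₀ (norm_nonneg _) (norm_nonneg _) two_ne_zero).1 ?_
        rw [norm_sq_formSpace]
        change ‖L x‖ ^ 2 = ‖((show D from x) : H)‖ ^ 2 + ((ofLift D hD L hL).form x x).re
        erw [ofLift_form_self_re]
        ring_nf }
  refine (completeSpace_iff_isComplete_range i.isometry.isUniformInducing).2 ?_
  have : Set.range i = K := by
    rw [← hrange]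
    rfl
  rw [this]
  exact hK.isComplete

end ofLift

/-! ### The absolutely continuous part and its closure -/

variable [CompleteSpace H]

theorem norm_coEmbedding_apply_le (q : PosForm H) (u : q.FormCompletion) :
    ‖q.coEmbedding u‖ ≤ ‖u‖ := by
  refine UniformSpace.Completion.induction_on u
    (isClosed_le (by fun_prop) (by fun_prop)) fun x => ?_
  have h : q.coEmbedding (x : q.FormCompletion) = q.inclusion x := q.coEmbedding_embed x
  rw [h, UniformSpace.Completion.norm_coe]
  exact (q.norm_inclusionₗ_le x).trans_eq (one_mul _)

theorem norm_coEmbedding_le (q : PosForm H) : ‖q.coEmbedding‖ ≤ 1 :=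
  ContinuousLinearMap.opNorm_le_bound _ zero_le_one fun u => by
    simpa using q.norm_coEmbedding_apply_le u

theorem domain_le_range_coEmbedding (q : PosForm H) :
    q.domain ≤ LinearMap.range (q.coEmbedding : q.FormCompletion →ₗ[ℂ] H) :=
  fun x hx => ⟨q.embed ⟨x, hx⟩, q.coEmbedding_embed ⟨x, hx⟩⟩

theorem norm_le_norm_orthogonalLift (q : PosForm H)
    (x : LinearMap.range (q.coEmbedding : q.FormCompletion →ₗ[ℂ] H)) :
    ‖(x : H)‖ ≤ ‖q.coEmbedding.orthogonalLift x‖ := by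
  have h := q.norm_coEmbedding_apply_le (q.coEmbedding.orthogonalLift x)
  rwa [ContinuousLinearMap.apply_orthogonalLift] at h

/-- The quotient form of `Ĥ(q)` on `range E_q`. -/
noncomputable def rangeForm (q : PosForm H) : PosForm H :=
  ofLift (LinearMap.range (q.coEmbedding : q.FormCompletion →ₗ[ℂ] H))
    (q.dense.mono q.domain_le_range_coEmbedding) q.coEmbedding.orthogonalLift
    q.norm_le_norm_orthogonalLift

/-- The restriction of `q.rangeForm` to the domain of `q`. -/
noncomputable def acPart (q : PosForm H) : PosForm H :=
  ofLift q.domain q.dense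
    (q.coEmbedding.orthogonalLift ∘ₗ Submodule.inclusion q.domain_le_range_coEmbedding)
    fun x => q.norm_le_norm_orthogonalLift (Submodule.inclusion q.domain_le_range_coEmbedding x)

theorem rangeForm_isClosed (q : PosForm H) : q.rangeForm.IsClosed := by
  refine ofLift_isClosed _ (Submodule.isClosed_orthogonal
    (LinearMap.ker (q.coEmbedding : q.FormCompletion →ₗ[ℂ] H))) (le_antisymm ?_ fun u hu => ?_)
  · rintro _ ⟨x, rfl⟩
    exact q.coEmbedding.orthogonalLift_mem x
  · exact ⟨⟨q.coEmbedding u, u, rfl⟩, q.coEmbedding.orthogonalLift_eq hu _ rfl⟩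

theorem rangeForm_isExtension_acPart (q : PosForm H) : q.rangeForm.IsExtension q.acPart :=
  ⟨q.domain_le_range_coEmbedding, fun _ _ => rfl⟩

theorem acPart_le (q : PosForm H) : q.acPart ≤ q := by
  refine ⟨le_rfl, fun x => ?_⟩
  have h1 : (q.acPart.form x x).re = ‖q.coEmbedding.orthogonalLift
      (Submodule.inclusion q.domain_le_range_coEmbedding x)‖ ^ 2 - ‖(x : H)‖ ^ 2 :=
    ofLift_form_self_re (D := q.domain) x
  have h2 := q.norm_sq_formSpace x
  have h3 : ‖q.coEmbedding.orthogonalLift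
      (Submodule.inclusion q.domain_le_range_coEmbedding x)‖ ≤ ‖(show q.FormSpace from x)‖ := by
    rw [q.coEmbedding.orthogonalLift_eq_starProjection (q.embed x) _ (q.coEmbedding_embed x),
      ← q.norm_embed]
    exact Submodule.norm_starProjection_apply_le _ _
  have h4 := pow_le_pow_left₀ (norm_nonneg _) h3 2
  have h5 : ‖q.inclusion (show q.FormSpace from x)‖ = ‖(x : H)‖ := rfl
  change (q.acPart.form x x).re ≤ _
  rw [h1]
  erw [h5] at h2
  linarith

/-- The co-embedding of `q` factors through every closed form `r ≤ q`. -/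
theorem exists_factor_coEmbedding {q r : PosForm H} (hr : r.IsClosed) (h : r ≤ q) :
    ∃ W : q.FormCompletion →L[ℂ] r.FormSpace,
      (∀ u, ‖W u‖ ≤ ‖u‖) ∧ ∀ u, r.inclusion (W u) = q.coEmbedding u := by
  have : CompleteSpace r.FormSpace := hr
  let f : q.FormSpace →ₗ[ℂ] r.FormSpace := Submodule.inclusion h.1
  let e : q.FormSpace →ₗ[ℂ] q.FormCompletion :=
    (UniformSpace.Completion.toComplL (𝕜 := ℂ) (E := q.FormSpace) :
      q.FormSpace →L[ℂ] q.FormCompletion)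
  have hincl (x : q.FormSpace) : r.inclusion (f x) = q.inclusion x := rfl
  have he : DenseRange e := UniformSpace.Completion.denseRange_coe (α := q.FormSpace)
  have hf (x : q.FormSpace) : ‖f x‖ ≤ 1 * ‖e x‖ := by
    have h0 : ‖e x‖ = ‖x‖ := UniformSpace.Completion.norm_coe x
    rw [h0, one_mul]
    refine le_of_sq_le_sq ?_ (norm_nonneg _)
    rw [norm_sq_formSpace, norm_sq_formSpace, hincl]
    have h1 : (r.form (f x) (f x)).re ≤ (q.form x x).re := h.2 x
    linarith
  refine ⟨f.extendOfNorm e, fun u => ?_, fun u => ?_⟩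
  · simpa using LinearMap.norm_extendOfNorm_apply_le he 1 hf u
  · refine UniformSpace.Completion.induction_on u
      (isClosed_eq (by fun_prop) (by fun_prop)) fun x => ?_
    have h1 : f.extendOfNorm e (x : q.FormCompletion) = f x :=
      LinearMap.extendOfNorm_eq he ⟨1, hf⟩ x
    rw [h1, hincl]
    exact (q.coEmbedding_embed x).symm

/-- For maximality, let `s` be a closed extension of a closeable `r ≤ q`. The contraction `W` for
`s` sends the lift of `x` to `x` itself, so the form norm of `x` for `s` is at most the norm of the
lift. -/
theorem acPart_isACPartOf (q : PosForm H) : q.acPart.IsACPartOf q := by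
  refine ⟨⟨⟨q.rangeForm, q.rangeForm_isClosed, q.rangeForm_isExtension_acPart⟩, q.acPart_le⟩, ?_⟩
  rintro r ⟨⟨s, hs, hsr⟩, hrq⟩
  have hsq : s ≤ q := le_trans' hsr.le hrq
  obtain ⟨W, hW, hWE⟩ := exists_factor_coEmbedding hs hsq
  refine ⟨hrq.1, fun x => ?_⟩
  change q.domain at x
  let y : LinearMap.range (q.coEmbedding : q.FormCompletion →ₗ[ℂ] H) :=
    Submodule.inclusion q.domain_le_range_coEmbedding x
  have h1 : (q.acPart.form x x).re = ‖q.coEmbedding.orthogonalLift y‖ ^ 2 - ‖(x : H)‖ ^ 2 :=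
    ofLift_form_self_re (D := q.domain) x
  have h2 : W (q.coEmbedding.orthogonalLift y) = (⟨x, hsq.1 x.2⟩ : s.domain) :=
    s.inclusion_injective ((hWE _).trans (q.coEmbedding.apply_orthogonalLift y))
  have h3 := pow_le_pow_left₀ (norm_nonneg _) (hW (q.coEmbedding.orthogonalLift y)) 2
  have h4 : ‖s.inclusion (W (q.coEmbedding.orthogonalLift y))‖ = ‖(x : H)‖ := by
    rw [hWE, q.coEmbedding.apply_orthogonalLift]
    rfl
  rw [norm_sq_formSpace, h4, h2] at h3
  have h5 := congrArg Complex.re (hsr.2 ⟨x, hrq.1 x.2⟩ ⟨x, hrq.1 x.2⟩)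
  refine h5.symm.le.trans (le_of_le_of_eq ?_ h1.symm)
  linarith

theorem rangeForm_isClosureOf (q : PosForm H) : q.rangeForm.IsClosureOf q.acPart := by
  refine ⟨q.rangeForm_isClosed, q.rangeForm_isExtension_acPart, fun r hr hext => ?_⟩
  obtain ⟨W, -, hWE⟩ := exists_factor_coEmbedding hr (le_trans' hext.le q.acPart_le)
  let P := (LinearMap.ker (q.coEmbedding : q.FormCompletion →ₗ[ℂ] H))ᗮ.starProjection
  -- On the dense image of `Dom q` both sides are the form inner product of `acPart`, which `r`
  -- extends. By continuity `W` is isometric on `(ker E)ᗮ`.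
  have hW (u v : q.FormCompletion) : ⟪W u, W v⟫_ℂ = ⟪P u, P v⟫_ℂ := by
    refine UniformSpace.Completion.induction_on₂ u v
      (isClosed_eq (by fun_prop) (by fun_prop)) fun x y => ?_
    change q.domain at x y
    change ⟪W (q.embed x), W (q.embed y)⟫_ℂ = ⟪P (q.embed x), P (q.embed y)⟫_ℂ
    have hx (z : q.domain) : W (q.embed z) = (⟨z, hext.1 z.2⟩ : r.domain) :=
      r.inclusion_injective ((hWE _).trans (q.coEmbedding_embed z))
    have hP (z : q.domain) : P (q.embed z) = q.coEmbedding.orthogonalLift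
        (Submodule.inclusion q.domain_le_range_coEmbedding z) :=
      (q.coEmbedding.orthogonalLift_eq_starProjection _ _ (q.coEmbedding_embed z)).symm
    rw [hx, hx, hP, hP]
    refine (r.formSpace_inner ⟨x, hext.1 x.2⟩ ⟨y, hext.1 y.2⟩).trans ?_
    rw [hext.2 x y]
    erw [ofLift_form]
    exact add_sub_cancel _ _
  have hdom (x : LinearMap.range (q.coEmbedding : q.FormCompletion →ₗ[ℂ] H)) :
      ∃ hx : (x : H) ∈ r.domain,
        W (q.coEmbedding.orthogonalLift x) = (⟨x, hx⟩ : r.domain) := by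
    have h : r.inclusion (W (q.coEmbedding.orthogonalLift x)) = x :=
      (hWE _).trans (q.coEmbedding.apply_orthogonalLift x)
    have hx : (x : H) ∈ r.domain := by
      rw [← h]
      exact Subtype.property (p := (· ∈ r.domain)) _
    exact ⟨hx, r.inclusion_injective h⟩
  refine ⟨fun x hx => (hdom ⟨x, hx⟩).1, fun x y => ?_⟩
  change LinearMap.range (q.coEmbedding : q.FormCompletion →ₗ[ℂ] H) at x y
  obtain ⟨hx, hWx⟩ := hdom x
  obtain ⟨hy, hWy⟩ := hdom y
  have hPL (z) : P (q.coEmbedding.orthogonalLift z) = q.coEmbedding.orthogonalLift z :=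
    Submodule.starProjection_eq_self_iff.2 (q.coEmbedding.orthogonalLift_mem z)
  have h1 := hW (q.coEmbedding.orthogonalLift x) (q.coEmbedding.orthogonalLift y)
  rw [hPL, hPL, hWx, hWy] at h1
  refine (eq_sub_of_add_eq' ((r.formSpace_inner ⟨x, hx⟩ ⟨y, hy⟩).symm.trans h1)).trans ?_
  rfl

/-! ### A form determines its operator -/

/-- The condition on the right says that `(S x, y)` lies in the adjoint graph of the root `S`, which
is the graph of `S`. The root thus drops out of the description of `T`. -/
theorem IsFormOf.mem_graph_iff {t : PosForm H} {T : H →ₗ.[ℂ] H} (h : t.IsFormOf T) {x y : H} :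
    (x, y) ∈ T.graph ↔
      ∃ hx : x ∈ t.domain, ∀ z : t.domain, t.form z ⟨x, hx⟩ = ⟪(z : H), y⟫_ℂ := by
  obtain ⟨-, S, ⟨⟨hS, -⟩, hST⟩, hdom, hform⟩ := h
  have hgraph : S.graph = S.graph.adjoint := by
    conv_lhs => rw [← LinearPMap.isSelfAdjoint_def.1 hS]
    exact LinearPMap.adjoint_graph_eq_graph_adjoint hS.dense_domain
  rw [hST]
  constructor
  · rintro ⟨w, hxw, hwy⟩
    have hx : x ∈ S.domain := LinearPMap.mem_domain_of_mem_graph hxw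
    refine ⟨hdom.ge hx, fun z => ?_⟩
    rw [hgraph, Submodule.mem_adjoint_iff] at hwy
    have := hwy z (S ⟨z, hdom.le z.2⟩) (S.mem_graph ⟨z, hdom.le z.2⟩)
    rw [hform, ← sub_eq_zero.1 this, S.mem_graph_snd_inj hxw (S.mem_graph ⟨x, hx⟩) rfl]
  · rintro ⟨hx, h⟩
    refine ⟨S ⟨x, hdom.le hx⟩, S.mem_graph ⟨x, hdom.le hx⟩, ?_⟩
    rw [hgraph, Submodule.mem_adjoint_iff]
    rintro a b hab
    have ha := LinearPMap.mem_domain_of_mem_graph hab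
    rw [S.mem_graph_snd_inj hab (S.mem_graph ⟨a, ha⟩) rfl, sub_eq_zero,
      ← h ⟨a, hdom.ge ha⟩, hform]

theorem IsFormOf.unique {t : PosForm H} {T T' : H →ₗ.[ℂ] H} (h : t.IsFormOf T)
    (h' : t.IsFormOf T') : T = T' :=
  LinearPMap.eq_of_eq_graph <| by
    ext ⟨x, y⟩
    rw [h.mem_graph_iff, h'.mem_graph_iff]

end PosForm

/-! ### Polar decomposition -/

namespace ContinuousLinearMap

variable {G H : Type*} [NormedAddCommGroup G] [InnerProductSpace ℂ G] [CompleteSpace G]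
  [NormedAddCommGroup H] [InnerProductSpace ℂ H] [CompleteSpace H]

theorem injective_self_comp_adjoint {E : G →L[ℂ] H} (hE : DenseRange E) :
    Function.Injective (E ∘L adjoint E) := by
  refine (injective_iff_map_eq_zero _).2 fun y hy => ?_
  have h0 : adjoint E y = 0 := by
    rw [← inner_self_eq_zero (𝕜 := ℂ), adjoint_inner_left]
    change ⟪y, (E ∘L adjoint E) y⟫_ℂ = 0
    rw [hy, inner_zero_right]
  refine hE.eq_zero_of_inner_left ℂ ?_
  intro u
  rw [← adjoint_inner_left, h0, inner_zero_left]

/-- Polar decomposition of `E†` for `E` with dense range: if `C ≥ 0` and `C² = E E†`, then there is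
an isometry `U` onto `(ker E)ᗮ` with `E† = U C`. -/
theorem exists_isometry_of_mul_self_eq {E : G →L[ℂ] H} {C : H →L[ℂ] H} (hC : IsSelfAdjoint C)
    (hCinj : Function.Injective C) (hCC : C * C = E ∘L adjoint E) :
    ∃ U : H →L[ℂ] G, (∀ z, E (U z) = C z) ∧ (∀ u, C (adjoint U u) = E u) ∧
      (∀ z w, ⟪U z, U w⟫_ℂ = ⟪z, w⟫_ℂ) ∧
      ∀ z, U z ∈ (LinearMap.ker (E : G →ₗ[ℂ] H))ᗮ := by
  have eB (y : H) : C (C y) = E (adjoint E y) := congrArg (fun F : H →L[ℂ] H => F y) hCC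
  have hd : DenseRange C := hC.denseRange_of_injective hCinj
  have hinner (y w : H) : ⟪adjoint E y, adjoint E w⟫_ℂ = ⟪C y, C w⟫_ℂ := by
    rw [adjoint_inner_left, ← eB, ← adjoint_inner_left, hC.adjoint_eq]
  have hnorm (y : H) : ‖(adjoint E : H →ₗ[ℂ] G) y‖ ≤ 1 * ‖(C : H →ₗ[ℂ] H) y‖ := by
    rw [one_mul]
    refine le_of_sq_le_sq ?_ (norm_nonneg _)
    rw [← inner_self_eq_norm_sq (𝕜 := ℂ), ← inner_self_eq_norm_sq (𝕜 := ℂ)]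
    exact (congrArg RCLike.re (hinner y y)).le
  -- `C y ↦ E† y` is well defined and isometric on the dense range of `C`, because `‖E† y‖ = ‖C y‖`.
  let U : H →L[ℂ] G := (adjoint E : H →ₗ[ℂ] G).extendOfNorm (C : H →ₗ[ℂ] H)
  have hU (y : H) : U (C y) = adjoint E y :=
    LinearMap.extendOfNorm_eq (e := (C : H →ₗ[ℂ] H)) hd ⟨1, hnorm⟩ y
  refine ⟨U, fun z => ?_, fun u => ?_, fun z w => ?_, fun z => ?_⟩
  · refine hd.induction_on z (isClosed_eq (by fun_prop) (by fun_prop)) fun y => ?_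
    rw [hU, eB]
  · refine ext_inner_left ℂ fun y => ?_
    rw [← adjoint_inner_left C, hC.adjoint_eq, adjoint_inner_right, hU, adjoint_inner_left]
  · refine hd.induction_on₂ (p := fun z w => ⟪U z, U w⟫_ℂ = ⟪z, w⟫_ℂ)
      (isClosed_eq (by fun_prop) (by fun_prop)) (fun y v => ?_) z w
    rw [hU, hU, hinner]
  · refine hd.induction_on (p := fun z => U z ∈ (LinearMap.ker (E : G →ₗ[ℂ] H))ᗮ) z
      ((Submodule.isClosed_orthogonal _).preimage U.continuous) fun y => ?_
    rw [hU, Submodule.mem_orthogonal]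
    intro n hn
    have hn : E n = 0 := hn
    rw [adjoint_inner_right, hn, inner_zero_left]

end ContinuousLinearMap

/-! ### The closed form as the form of `(E E†)⁻¹ - 1` -/

namespace PosForm

open ContinuousLinearMap

variable {H : Type*} [NormedAddCommGroup H] [InnerProductSpace ℂ H] [CompleteSpace H]

theorem denseRange_coEmbedding (q : PosForm H) : DenseRange q.coEmbedding :=
  q.rangeForm.dense

theorem rangeForm_isFormOf (q : PosForm H) :
    q.rangeForm.IsFormOf (rangePMap (q.coEmbedding ∘L adjoint q.coEmbedding)
      (1 - q.coEmbedding ∘L adjoint q.coEmbedding)) := by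
  set E := q.coEmbedding
  set B : H →L[ℂ] H := E ∘L adjoint E
  have hB : Function.Injective B := injective_self_comp_adjoint q.denseRange_coEmbedding
  have hB0 : 0 ≤ B := (nonneg_iff_isPositive _).2 (isPositive_self_comp_adjoint E)
  have hB1 : B ≤ 1 := by
    refine (CStarAlgebra.norm_le_one_iff_of_nonneg B hB0).1 ?_
    refine (opNorm_comp_le _ _).trans ?_
    rw [LinearIsometryEquiv.norm_map]
    exact mul_le_one₀ q.norm_coEmbedding_le (norm_nonneg _) q.norm_coEmbedding_le
  set C : H →L[ℂ] H := CFC.sqrt B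
  set D : H →L[ℂ] H := CFC.sqrt (1 - B)
  have hCC : C * C = B := CFC.sqrt_mul_sqrt_self B hB0
  have hDD : D * D = 1 - B := CFC.sqrt_mul_sqrt_self (1 - B) (sub_nonneg.2 hB1)
  have hC0 : 0 ≤ C := CFC.sqrt_nonneg _
  have hD0 : 0 ≤ D := CFC.sqrt_nonneg _
  have hCD : Commute C D := by
    have h1 : Commute B (1 - B) := (Commute.one_right B).sub_right (Commute.refl B)
    have h2 : Commute C (1 - B) := by
      rw [show C = _ from CFC.sqrt_eq_cfc]
      exact h1.cfc_nnreal _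
    rw [show D = _ from CFC.sqrt_eq_cfc]
    exact (h2.symm.cfc_nnreal _).symm
  have hC : Function.Injective C := by
    refine Function.Injective.of_comp (f := C) ?_
    rw [← hCC] at hB
    exact hB
  have hCs := IsSelfAdjoint.of_nonneg hC0
  obtain ⟨U, hEU, hCU, hUU, hUker⟩ := exists_isometry_of_mul_self_eq hCs hC hCC
  refine ⟨isPosSelfAdjoint_rangePMap_one_sub hB hB0 hB1, rangePMap C D,
    isPosSqrtOf_rangePMap hC hC0 hD0 hCC hDD hCD, ?_, ?_⟩
  -- `C U† = E` and `E U = C` give the two inclusions between `range E` and `range C`.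
  · ext x
    rw [mem_domain_rangePMap hC]
    constructor
    · rintro ⟨u, rfl⟩
      exact ⟨adjoint U u, hCU u⟩
    · rintro ⟨z, rfl⟩
      exact ⟨U z, hEU z⟩
  · intro x y
    generalize_proofs hx hy
    obtain ⟨z, hz⟩ := (mem_domain_rangePMap hC).1 hx
    obtain ⟨w, hw⟩ := (mem_domain_rangePMap hC).1 hy
    rw [rangePMap_apply hC ⟨x, hx⟩ hz, rangePMap_apply hC ⟨y, hy⟩ hw]
    -- `U z` lies in `(ker E)ᗮ` over `C z = x`, so it is the lift of `x`; `U` preserves inner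
    -- products.
    have h1 : q.rangeForm.form x y = ⟪z, w⟫_ℂ - ⟪(x : H), (y : H)⟫_ℂ :=
      (congrArg₂ (fun a b => ⟪a, b⟫_ℂ - ⟪(x : H), (y : H)⟫_ℂ)
        (E.orthogonalLift_eq (hUker z) x ((hEU z).trans hz))
        (E.orthogonalLift_eq (hUker w) y ((hEU w).trans hw))).trans
        (congrArg (· - ⟪(x : H), (y : H)⟫_ℂ) (hUU z w))
    have hsum : C (C w) + D (D w) = w := by
      have h : C * C + D * D = 1 := by rw [hCC, hDD]; abel
      exact congrArg (fun F : H →L[ℂ] H => F w) h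
    rw [h1, ← hz, ← hw, ← adjoint_inner_right C, ← adjoint_inner_right D, hCs.adjoint_eq,
      (IsSelfAdjoint.of_nonneg hD0).adjoint_eq, ← inner_sub_right]
    exact congrArg _ (sub_eq_of_eq_add' hsum.symm)

end PosForm

theorem theorem4p7 {H : Type*} [NormedAddCommGroup H] [InnerProductSpace ℂ H] [CompleteSpace H]
    [TopologicalSpace.SeparableSpace H] (q : PosForm H) :
    -- the operator `T` whose form is the closure of the absolutely continuous part exists ...
    (∃! T : H →ₗ.[ℂ] H, ∃ qac qT : PosForm H,
      qac.IsACPartOf q ∧ qT.IsClosureOf qac ∧ qT.IsFormOf T) ∧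
    -- ... the co-embedding is contractive, and `(I + T)⁻¹ = E_q E_q*`
    ‖q.coEmbedding‖ ≤ 1 ∧
    ∀ (qac qT : PosForm H) (T : H →ₗ.[ℂ] H),
      qac.IsACPartOf q → qT.IsClosureOf qac → qT.IsFormOf T →
        ((LinearMap.id : H →ₗ[ℂ] H) +ᵥ T).HasBoundedInverse
          (q.coEmbedding ∘L ContinuousLinearMap.adjoint q.coEmbedding) := by
  have key (qac qT : PosForm H) (T : H →ₗ.[ℂ] H) (hac : qac.IsACPartOf q)
      (hcl : qT.IsClosureOf qac) (hT : qT.IsFormOf T) :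
      T = ContinuousLinearMap.rangePMap
        (q.coEmbedding ∘L ContinuousLinearMap.adjoint q.coEmbedding)
        (1 - q.coEmbedding ∘L ContinuousLinearMap.adjoint q.coEmbedding) := by
    obtain rfl := hac.unique q.acPart_isACPartOf
    obtain rfl := hcl.unique q.rangeForm_isClosureOf
    exact hT.unique q.rangeForm_isFormOf
  refine ⟨⟨_, ⟨q.acPart, q.rangeForm, q.acPart_isACPartOf, q.rangeForm_isClosureOf,
    q.rangeForm_isFormOf⟩, ?_⟩, q.norm_coEmbedding_le, ?_⟩
  · rintro T ⟨qac, qT, hac, hcl, hT⟩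
    exact key qac qT T hac hcl hT
  · intro qac qT T hac hcl hT
    rw [key qac qT T hac hcl hT]
    exact ContinuousLinearMap.hasBoundedInverse_id_vadd_rangePMap
      (ContinuousLinearMap.injective_self_comp_adjoint q.denseRange_coEmbedding)
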